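/- Let $f:\mathbb R^n\times\mathbb R^m\to\mathbb R$, $\phi:\mathbb R^n\to\mathbb R^p$ and $\varphi:\mathbb R^n\times\mathbb R^m\to\mathbb R^q$ be smooth (continuously differentiable), let $C\subseteq\mathbb R^p$ and $D\subseteq\mathbb R^q$ be closed and convex, and consider the problem $\min_{x\in X}\max_{y\in Y(x)}f(x,y)$ with $$X=\{x\in\mathbb R^n:\phi(x)\in C\},\qquad Y(x)=\{y\in\mathbb R^m:\varphi(x,y)\in D\}.$$ Let $\mathbb B_\delta(z)$ denote the closed Euclidean ball and $\operatorname{dist}$ the Euclidean distance, with $\operatorname{dist}(z,\emptyset)=\infty$. For a set $S\subseteq\mathbb R^r$ and $\bar z\in S$ let $$T_S(\bar z)=\{w:\exists\,t_k\downarrow0,\ w_k\to w,\ \bar z+t_kw_k\in S\},\qquad \widehat N_S(\bar z)=\{v:\langle v,z-\bar z\rangle\le o(\|z-\bar z\|)\ \ \forall z\in S\},$$ $$N_S(\bar z)=\{v:\exists\,z_k\to\bar z,\ z_k\in S,\ v_k\to v,\ v_k\in\widehat N_S(z_k)\}$$ be the tangent, the regular normal and the limiting normal cone (for closed convex $S$,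 $N_S$ is the normal cone of convex analysis). For a direction $u\in\mathbb R^n$ put $\mathbb L(\bar x,\bar y;u)=\{h\in\mathbb R^m:\nabla\varphi(\bar x,\bar y)(u,h)\in T_D(\varphi(\bar x,\bar y))\}$, and let $$L(x,y,\alpha,\beta)=f(x,y)+\phi(x)^T\alpha-\varphi(x,y)^T\beta .$$ Let $(\bar x,\bar y)$, with $\bar x\in X$ and $\bar y\in Y(\bar x)$, be a calm local minimax point: there are $\delta_0>0$, $\kappa>0$ and $\tau:\mathbb R_+\to\mathbb R_+$ with $\tau(\delta)\to0$ as $\delta\downarrow0$ and $\tau(\delta)\le\kappa\delta$ for all small $\delta>0$ such that, for all $\delta\in(0,\delta_0]$, $x\in X\cap\mathbb B_\delta(\bar x)$ and $y\in Y(\bar x)\cap\mathbb B_\delta(\bar y)$, the set $Y(x)\cap\mathbb B_{\tau(\delta)}(\bar y)$ is nonempty and $$f(\bar x,y)\le f(\bar x,\bar y)\le\max_{y'\in Y(x)\cap\mathbb B_{\tau(\delta)}(\bar y)}f(x,y').$$ Suppose that: 1. (MSCQ for $X$ at $\bar x$) there are $\rho>0$ and a neighborhood $U$ of $\bar x$ with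 $\operatorname{dist}(x,X)\le\rho\operatorname{dist}(\phi(x),C)$ for all $x\in U$; 2. (MSCQ for $Y(\bar x)$ at $\bar y$) there are $\rho>0$ and a neighborhood $V$ of $\bar y$ with $\operatorname{dist}(y,Y(\bar x))\le\rho\operatorname{dist}(\varphi(\bar x,y),D)$ for all $y\in V$; 3. (Robinson stability of $Y$ at $(\bar x,\bar y)$) there are $\kappa'\ge0$ and neighborhoods $U$ of $\bar x$ and $V$ of $\bar y$ with $\operatorname{dist}(y,Y(x))\le\kappa'\operatorname{dist}(\varphi(x,y),D)$ for all $(x,y)\in U\times V$; 4. (directional regularity) for all $u\in T_X(\bar x)$ and $h\in\mathbb L(\bar x,\bar y;u)$, $$\nabla_y\varphi(\bar x,\bar y)^T\beta=0,\quad \beta\in N_D(\varphi(\bar x,\bar y)),\quad \langle\beta,\nabla\varphi(\bar x,\bar y)(u,h)\rangle=0\quad\Longrightarrow\quad\beta=0 .$$ Then there exist $\alpha\in N_C(\phi(\bar x))$ and $\beta\in N_D(\varphi(\bar x,\bar y))$ with $\nabla_{(x,y)}L(\bar x,\bar y,\alpha,\beta)=0$. -/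

import Mathlib

open Filter Topology
open scoped NNReal ENNReal

namespace CalmMinimax

section Cones

variable {E : Type*} [NormedAddCommGroup E] [InnerProductSpace ℝ E]

/-- The tangent (contingent) cone to `S` at `z`. -/
def contingentCone (S : Set E) (z : E) : Set E :=
  {w | ∃ (t : ℕ → ℝ) (v : ℕ → E), (∀ k, 0 < t k) ∧ Tendsto t atTop (𝓝 0) ∧
    Tendsto v atTop (𝓝 w) ∧ ∀ k, z + t k • v k ∈ S}

/-- The regular (Fréchet) normal cone: `⟪v, z' - z⟫ ≤ o(‖z' - z‖)` for `z' ∈ S`. -/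
def regularNormalCone (S : Set E) (z : E) : Set E :=
  {v | ∀ ε : ℝ, 0 < ε → ∀ᶠ z' in 𝓝[S] z, inner ℝ v (z' - z) ≤ ε * ‖z' - z‖}

/-- The limiting (Mordukhovich) normal cone; for closed convex `S` it is the normal cone of convex
analysis. -/
def normalCone (S : Set E) (z : E) : Set E :=
  {v | ∃ (zs : ℕ → E) (vs : ℕ → E), (∀ k, zs k ∈ S) ∧ Tendsto zs atTop (𝓝 z) ∧
    Tendsto vs atTop (𝓝 v) ∧ ∀ k, vs k ∈ regularNormalCone S (zs k)}

end Cones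

section Constraints

variable {E F G : Type*} [NormedAddCommGroup E] [NormedAddCommGroup F] [NormedAddCommGroup G]

/-- The metric subregularity constraint qualification for the system `g z ∈ Sig` at a feasible
point `z₀`. Distances are extended-valued, so that the distance to the empty set is `∞`. -/
def MSCQ (g : E → G) (Sig : Set G) (z₀ : E) : Prop :=
  g z₀ ∈ Sig ∧ ∃ U ∈ 𝓝 z₀, ∃ ρ : ℝ≥0, 0 < ρ ∧
    ∀ z ∈ U, Metric.infEDist z {z' | g z' ∈ Sig} ≤ ρ * Metric.infEDist (g z) Sig

/-- Robinson stability at `(x₀, y₀)` of the set-valued map `x ↦ {y | g (x, y) ∈ D}`.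
The distance to an empty value of the map is `∞`. -/
def RobinsonStable (g : E × F → G) (D : Set G) (x₀ : E) (y₀ : F) : Prop :=
  g (x₀, y₀) ∈ D ∧ ∃ κ : ℝ≥0, ∃ U ∈ 𝓝 x₀, ∃ V ∈ 𝓝 y₀,
    ∀ x ∈ U, ∀ y ∈ V,
      Metric.infEDist y {y' | g (x, y') ∈ D} ≤ κ * Metric.infEDist (g (x, y)) D

/-- `(x₀, y₀)` is a calm local minimax point of `min_{x ∈ X} max_{y ∈ Y x} f (x, y)`.
That `M` is the greatest element says that the local maximum is attained with value `M`, in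
particular that `Y x` meets the closed ball of radius `τ δ` about `y₀`. -/
def IsCalmLocalMinimax (f : E × F → ℝ) (X : Set E) (Y : E → Set F) (x₀ : E) (y₀ : F) : Prop :=
  x₀ ∈ X ∧ y₀ ∈ Y x₀ ∧
  ∃ (δ₀ : ℝ≥0) (τ : ℝ≥0 → ℝ≥0), 0 < δ₀ ∧ Tendsto τ (𝓝[>] 0) (𝓝 0) ∧
    (∃ κ : ℝ≥0, 0 < κ ∧ ∀ᶠ δ in 𝓝[>] 0, τ δ ≤ κ * δ) ∧
    ∀ δ : ℝ≥0, 0 < δ → δ ≤ δ₀ →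
      ∀ x ∈ X ∩ Metric.closedBall x₀ δ, ∀ y ∈ Y x₀ ∩ Metric.closedBall y₀ δ,
        f (x₀, y) ≤ f (x₀, y₀) ∧
        ∃ M : ℝ, IsGreatest ((fun y' => f (x, y')) '' (Y x ∩ Metric.closedBall y₀ (τ δ))) M ∧
          f (x₀, y₀) ≤ M

end Constraints

section SetConstrained

variable {E F P Q : Type*}
  [NormedAddCommGroup E] [InnerProductSpace ℝ E] [NormedAddCommGroup F] [InnerProductSpace ℝ F]
  [NormedAddCommGroup P] [InnerProductSpace ℝ P] [NormedAddCommGroup Q] [InnerProductSpace ℝ Q]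

/-- The set `𝕃(x₀, y₀; u)` of all `h` with `∇g(x₀, y₀)(u, h) ∈ T_D(g(x₀, y₀))`. -/
def linearizedCone (g : E × F → Q) (D : Set Q) (x₀ : E) (y₀ : F) (u : E) : Set F :=
  {h | fderiv ℝ g (x₀, y₀) (u, h) ∈ contingentCone D (g (x₀, y₀))}

/-- The directional regularity condition in the direction `(u, h)`:
`∇_y g(x₀, y₀)ᵀ β = 0` and `β ∈ N_D(g(x₀, y₀)) ∩ {∇g(x₀, y₀)(u, h)}^⊥` imply `β = 0`. -/
def DirectionallyRegular [CompleteSpace F] [CompleteSpace Q] (g : E × F → Q) (D : Set Q)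
    (x₀ : E) (y₀ : F) (u : E) (h : F) : Prop :=
  ∀ β ∈ normalCone D (g (x₀, y₀)), inner ℝ β (fderiv ℝ g (x₀, y₀) (u, h)) = 0 →
    ContinuousLinearMap.adjoint (fderiv ℝ (fun y => g (x₀, y)) y₀) β = 0 → β = 0

/-- The Lagrangian `L(x, y, α, β) = f(x, y) + phi(x)ᵀ α - varphi(x, y)ᵀ β`. -/
noncomputable def lagrangian (f : E × F → ℝ) (phi : E → P) (varphi : E × F → Q)
    (x : E) (y : F) (α : P) (β : Q) : ℝ :=
  f (x, y) + inner ℝ (phi x) α - inner ℝ (varphi (x, y)) β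

end SetConstrained

end CalmMinimax

/-! The multiplier `β` is found first, from `y₀` being a local maximizer of `f (x₀, ·)` on `Y x₀`.
It therefore does not depend on any direction in `x`. For `u` tangent to `X`, calmness bounds the
maximizing responses linearly, so they accumulate at some `v` with `(u, v)` tangent to the graph of
`Y` and `f' (u, v) ≥ 0` (`IsCalmLocalMinimax.exists_fderiv_nonneg`). Convexity of `D` makes `β`
nonpositive on `varphi' (u, v)`. Subtracting the two, the `v` terms cancel by the choice of `β`, so
`u ↦ f' (u, 0) - ⟪β, varphi' (u, 0)⟫` is nonnegative on the tangent cone of `X`, and `α` is its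
multiplier. Both multipliers come from `MSCQ.exists_multiplier`: subregularity penalizes the
functional by a distance to a cone, and Hahn-Banach does the rest, with no closedness of image
cones. -/

namespace CalmMinimax

/-! ### Separation from a convex cone by Hahn-Banach. -/

section Separation

variable {E G : Type*} [NormedAddCommGroup E] [InnerProductSpace ℝ E]
  [NormedAddCommGroup G] [InnerProductSpace ℝ G]

theorem infDist_add_le_of_convexCone (K : ConvexCone ℝ G) (hK : (K : Set G).Nonempty) (v w : G) :
    Metric.infDist (v + w) K ≤ Metric.infDist v K + Metric.infDist w K := by
  refine le_of_forall_pos_lt_add fun ε hε => ?_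
  obtain ⟨a, ha, hva⟩ := (Metric.infDist_lt_iff (x := v) hK).1
    (lt_add_of_pos_right _ (half_pos hε))
  obtain ⟨b, hb, hwb⟩ := (Metric.infDist_lt_iff (x := w) hK).1
    (lt_add_of_pos_right _ (half_pos hε))
  have h1 : Metric.infDist (v + w) K ≤ dist (v + w) (a + b) :=
    Metric.infDist_le_dist_of_mem (K.add_mem ha hb)
  have h2 := dist_add_add_le v w a b
  linarith

theorem infDist_smul_le_of_convexCone (K : ConvexCone ℝ G) (hK : (K : Set G).Nonempty)
    {c : ℝ} (hc : 0 < c) (v : G) :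
    Metric.infDist (c • v) K ≤ c * Metric.infDist v K := by
  rw [← div_le_iff₀' hc, Metric.le_infDist hK]
  intro a ha
  rw [div_le_iff₀' hc]
  calc Metric.infDist (c • v) K ≤ dist (c • v) (c • a) :=
        Metric.infDist_le_dist_of_mem (K.smul_mem hc ha)
    _ = c * dist v a := by rw [dist_smul₀, Real.norm_of_nonneg hc.le]

theorem infDist_smul_of_convexCone (K : ConvexCone ℝ G) (hK : (K : Set G).Nonempty)
    {c : ℝ} (hc : 0 < c) (v : G) :
    Metric.infDist (c • v) K = c * Metric.infDist v K := by
  refine (infDist_smul_le_of_convexCone K hK hc v).antisymm ?_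
  have h := infDist_smul_le_of_convexCone K hK (inv_pos.2 hc) (c • v)
  rwa [inv_smul_smul₀ hc.ne', ← div_eq_inv_mul, le_div_iff₀' hc] at h

/-- A linear functional that is penalized by the distance of `L u` to a convex cone factors
through `L` by an element of the polar cone. -/
theorem exists_multiplier_of_le_norm_sub [FiniteDimensional ℝ G] (L : E →ₗ[ℝ] G) (c : E →ₗ[ℝ] ℝ)
    (K : ConvexCone ℝ G) (hK : (0 : G) ∈ K) {M : ℝ} (hM : 0 ≤ M)
    (hc : ∀ u, ∀ w ∈ K, c u ≤ M * ‖L u - w‖) :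
    ∃ l : G, (∀ w ∈ K, inner ℝ l w ≤ 0) ∧ ∀ u, inner ℝ l (L u) = c u := by
  have hne : (K : Set G).Nonempty := ⟨0, hK⟩
  have hdist : ∀ u, c u ≤ M * Metric.infDist (L u) K := by
    intro u
    rcases hM.eq_or_lt with rfl | hM
    · simpa using hc u 0 hK
    rw [← div_le_iff₀' hM, Metric.le_infDist hne]
    intro w hw
    rw [div_le_iff₀' hM, dist_eq_norm]
    exact hc u w hw
  -- The bound at `u` and `-u` with `w = 0` makes `c` vanish on the kernel, so `c ∘ₗ s` below does
  -- not depend on the section `s`.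
  have hker : ∀ u, L u = 0 → c u = 0 := by
    intro u hu
    have h1 := hc u 0 hK
    have h2 := hc (-u) 0 hK
    simp only [map_neg, hu, sub_zero, neg_zero, norm_zero, mul_zero] at h1 h2
    linarith
  obtain ⟨s, hs⟩ := L.rangeRestrict.exists_rightInverse_of_surjective L.range_rangeRestrict
  have hLs : ∀ x, L (s x) = x := fun x => congrArg Subtype.val (LinearMap.congr_fun hs x)
  -- The distance to a convex cone is sublinear and vanishes on the cone, so a dominated extension
  -- is automatically polar to `K`.
  obtain ⟨g, hg, hgN⟩ := exists_extension_of_le_sublinear ⟨LinearMap.range L, c ∘ₗ s⟩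
    (fun v => M * Metric.infDist v K)
    (fun r hr v => by rw [infDist_smul_of_convexCone K hne hr]; ring)
    (fun v w => by
      rw [← mul_add]
      exact mul_le_mul_of_nonneg_left (infDist_add_le_of_convexCone K hne v w) hM)
    (fun x => by
      have h := hdist (s x)
      rw [hLs] at h
      exact h)
  refine ⟨(InnerProductSpace.toDual ℝ G).symm (LinearMap.toContinuousLinearMap g), ?_, ?_⟩
  · intro w hw
    have h := hgN w
    rw [Metric.infDist_zero_of_mem hw, mul_zero] at h
    simpa using h
  · intro u
    have h := hg ⟨L u, u, rfl⟩
    have h2 := hker (s ⟨L u, u, rfl⟩ - u) (by rw [map_sub, hLs, sub_self])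
    rw [map_sub, sub_eq_zero] at h2
    simpa using h.trans h2

end Separation

/-! ### Normal vectors from metric subregularity. -/

section Multipliers

variable {E G : Type*} [NormedAddCommGroup E] [InnerProductSpace ℝ E]
  [NormedAddCommGroup G] [InnerProductSpace ℝ G]

theorem mem_normalCone_of_forall_inner_le {S : Set G} {z v : G} (hz : z ∈ S)
    (hv : ∀ s ∈ S, inner ℝ v (s - z) ≤ 0) : v ∈ normalCone S z := by
  refine ⟨fun _ => z, fun _ => v, fun _ => hz, tendsto_const_nhds, tendsto_const_nhds,
    fun _ ε hε => ?_⟩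
  filter_upwards [self_mem_nhdsWithin] with s hs
  exact (hv s hs).trans (by positivity)

/-- Bounded feasible difference quotients along `t ↓ 0` accumulate at a contingent direction. -/
theorem exists_contingent_of_eventually [FiniteDimensional ℝ E] {S : Set E} {z u : E}
    {r : ℝ → ℝ} {r₀ : ℝ} (hr : Tendsto r (𝓝[>] 0) (𝓝 r₀))
    (h : ∀ᶠ t in 𝓝[>] (0 : ℝ), ∃ v, z + t • v ∈ S ∧ ‖v - u‖ ≤ r t) :
    ∃ v ∈ contingentCone S z, ‖v - u‖ ≤ r₀ := by
  have hb : ∀ᶠ t in 𝓝[>] (0 : ℝ), r t < r₀ + 1 := hr.eventually_lt_const (by linarith)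
  have hall : ∀ᶠ t in 𝓝[>] (0 : ℝ), 0 < t ∧ r t < r₀ + 1 ∧
      ∃ v, z + t • v ∈ S ∧ ‖v - u‖ ≤ r t :=
    (eventually_mem_nhdsWithin.mono fun _ h => h).and (hb.and h)
  obtain ⟨t, ht, htall⟩ := exists_seq_forall_of_frequently hall.frequently
  choose htpos htr v hvS hvr using htall
  have hmem : ∀ k, v k ∈ Metric.closedBall u (r₀ + 1) := fun k => by
    rw [mem_closedBall_iff_norm]
    exact (hvr k).trans (htr k).le
  obtain ⟨a, -, φ, hφ, hva⟩ := (isCompact_closedBall u (r₀ + 1)).tendsto_subseq hmem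
  refine ⟨a, ⟨t ∘ φ, v ∘ φ, fun k => htpos _,
    (ht.mono_right nhdsWithin_le_nhds).comp hφ.tendsto_atTop, hva, fun k => hvS _⟩, ?_⟩
  exact le_of_tendsto_of_tendsto' (hva.sub_const u).norm ((hr.comp ht).comp hφ.tendsto_atTop)
    fun k => hvr _

/-- The point `z + t • u` misses the constraint by at most `t * ‖L u - w‖ + o(t)`, since `g z + t •
w` lies in `Sig`. Subregularity gives a feasible point within `ρ` times that; divide by `t` and pass
to the limit. -/
theorem MSCQ.exists_contingent_norm_sub_le [FiniteDimensional ℝ E] {g : E → G} {Sig : Set G}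
    {z : E} {L : E →L[ℝ] G} {U : Set E} (hU : U ∈ 𝓝 z) {ρ : ℝ≥0}
    (hρ : ∀ x ∈ U, Metric.infEDist x {z' | g z' ∈ Sig} ≤ ρ * Metric.infEDist (g x) Sig)
    (hL : HasFDerivAt g L z) (u : E) {w : G}
    (hw : ∀ᶠ t in 𝓝[>] (0 : ℝ), g z + t • w ∈ Sig) :
    ∃ v ∈ contingentCone {z' | g z' ∈ Sig} z, ‖v - u‖ ≤ ρ * ‖L u - w‖ := by
  have hid : Tendsto (fun t : ℝ => t) (𝓝[>] 0) (𝓝 0) := tendsto_id.mono_left nhdsWithin_le_nhds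
  have hquot : Tendsto (fun t : ℝ => t⁻¹ • (g (z + t • u) - g z)) (𝓝[>] 0) (𝓝 (L u)) := by
    refine hL.hasFDerivWithinAt.lim (s := Set.univ) ?_ (.of_forall fun _ => Set.mem_univ _) ?_
    · simpa using hid.smul_const u
    · refine tendsto_nhds_of_eventually_eq ?_
      filter_upwards [self_mem_nhdsWithin] with t ht
      exact inv_smul_smul₀ (ne_of_gt ht) u
  have hUt : ∀ᶠ t in 𝓝[>] (0 : ℝ), z + t • u ∈ U := by
    have : Tendsto (fun t : ℝ => z + t • u) (𝓝[>] 0) (𝓝 z) := by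
      simpa using (hid.smul_const u).const_add z
    exact this hU
  have hr : Tendsto (fun t : ℝ => ρ * ‖t⁻¹ • (g (z + t • u) - g z) - w‖ + t) (𝓝[>] 0)
      (𝓝 (ρ * ‖L u - w‖)) := by
    simpa using ((hquot.sub_const w).norm.const_mul (ρ : ℝ)).add hid
  refine exists_contingent_of_eventually hr ?_
  filter_upwards [self_mem_nhdsWithin, hUt, hw] with t (ht : 0 < t) htU htw
  -- The slack `t * t` makes the inequality strict, so a near-closest feasible point exists; after
  -- division by `t` it still vanishes.
  have h1 : Metric.infEDist (z + t • u) {z' | g z' ∈ Sig} <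
      ENNReal.ofReal (ρ * ‖g (z + t • u) - (g z + t • w)‖ + t * t) := by
    calc _ ≤ ρ * Metric.infEDist (g (z + t • u)) Sig := hρ _ htU
      _ ≤ ρ * edist (g (z + t • u)) (g z + t • w) := by
          gcongr; exact Metric.infEDist_le_edist_of_mem htw
      _ = ENNReal.ofReal (ρ * ‖g (z + t • u) - (g z + t • w)‖) := by
          rw [ENNReal.ofReal_mul ρ.coe_nonneg, ENNReal.ofReal_coe_nnreal, edist_dist, dist_eq_norm]
      _ < _ := (ENNReal.ofReal_lt_ofReal_iff (by positivity)).2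
          (lt_add_of_pos_right _ (mul_pos ht ht))
  obtain ⟨y, hy, hyd⟩ := Metric.infEDist_lt_iff.1 h1
  rw [edist_dist, ENNReal.ofReal_lt_ofReal_iff (by positivity), dist_eq_norm] at hyd
  refine ⟨t⁻¹ • (y - z), ?_, ?_⟩
  · rw [smul_inv_smul₀ ht.ne', add_sub_cancel]
    exact hy
  · have e1 : t⁻¹ • (y - z) - u = -(t⁻¹ • (z + t • u - y)) := by
      rw [smul_sub, smul_sub, smul_add, inv_smul_smul₀ ht.ne']; abel
    have e2 : t⁻¹ • (g (z + t • u) - g z) - w = t⁻¹ • (g (z + t • u) - (g z + t • w)) := by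
      rw [smul_sub, smul_sub, smul_add, inv_smul_smul₀ ht.ne']; abel
    rw [e1, e2, norm_neg, norm_smul, norm_smul, norm_inv, Real.norm_of_nonneg ht.le]
    calc _ ≤ t⁻¹ * (ρ * ‖g (z + t • u) - (g z + t • w)‖ + t * t) := by gcongr
      _ = _ := by field_simp

/-- Under metric subregularity, the polar of the contingent cone of `{z | g z ∈ Sig}` consists of
the vectors `∇g(z)ᵀ l` with `l` normal to the convex set `Sig`. -/
theorem MSCQ.exists_multiplier [FiniteDimensional ℝ E] [FiniteDimensional ℝ G]
    {g : E → G} {Sig : Set G} {z : E} (h : MSCQ g Sig z) (hSig : Convex ℝ Sig)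
    {L : E →L[ℝ] G} (hL : HasFDerivAt g L z) (c : E →L[ℝ] ℝ)
    (hc : ∀ v ∈ contingentCone {z' | g z' ∈ Sig} z, c v ≤ 0) :
    ∃ l : G, (∀ s ∈ Sig, inner ℝ l (s - g z) ≤ 0) ∧ ∀ u, inner ℝ l (L u) = c u := by
  obtain ⟨hz, U, hU, ρ, -, hρ⟩ := h
  have hS : Convex ℝ ((fun v => g z + v) ⁻¹' Sig) := hSig.translate_preimage_right (g z)
  have hz0 : (0 : G) ∈ (fun v => g z + v) ⁻¹' Sig := by simpa using hz
  -- The cone is generated by `Sig - g z`. The constant comes from `c u = c v + c (u - v)` with `v`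
  -- tangent and `‖v - u‖ ≤ ρ * ‖L u - w‖`.
  obtain ⟨l, hl, hlu⟩ := exists_multiplier_of_le_norm_sub L.toLinearMap c.toLinearMap
    (ConvexCone.hull ℝ ((fun v => g z + v) ⁻¹' Sig)) (ConvexCone.subset_hull hz0)
    (M := ‖c‖ * ρ) (by positivity) (by
      intro u w hw
      obtain ⟨r, hr, s, hs, rfl⟩ := (ConvexCone.mem_hull_of_convex hS).1 hw
      obtain ⟨v, hv, hvu⟩ := MSCQ.exists_contingent_norm_sub_le hU hρ hL u (w := r • s) (by
        -- For `t < r⁻¹` the factor `t * r` is below `1`, so convexity keeps the point in `Sig`.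
        have hev : ∀ᶠ t in 𝓝[>] (0 : ℝ), t < r⁻¹ :=
          (tendsto_id.mono_left nhdsWithin_le_nhds).eventually_lt_const (inv_pos.2 hr)
        filter_upwards [self_mem_nhdsWithin, hev] with t (ht : 0 < t) htr
        rw [smul_smul]
        exact hS.smul_mem_of_zero_mem hz0 hs
          ⟨by positivity, by rw [lt_inv_comm₀ ht hr, ← one_div, lt_div_iff₀ ht] at htr; linarith⟩)
      have h1 : c (u - v) ≤ ‖c‖ * ‖u - v‖ := (le_abs_self _).trans (c.le_opNorm _)
      have h2 : ‖c‖ * ‖u - v‖ ≤ ‖c‖ * (ρ * ‖L u - r • s‖) := by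
        rw [norm_sub_rev]; gcongr
      have h3 := hc v hv
      rw [map_sub] at h1
      simp only [ContinuousLinearMap.coe_coe]
      rw [mul_assoc]
      linarith)
  refine ⟨l, fun s hs => hl _ (ConvexCone.subset_hull ?_), hlu⟩
  simpa using hs

end Multipliers

/-! ### First-order consequences of the minimax inequalities. -/

section FirstOrder

variable {E F : Type*} [NormedAddCommGroup E] [InnerProductSpace ℝ E]
  [NormedAddCommGroup F] [InnerProductSpace ℝ F]
  {f : E × F → ℝ} {X : Set E} {Y : E → Set F} {x₀ : E} {y₀ : F} {f' : E × F →L[ℝ] ℝ}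

/-- The local maximality of `y₀` in first-order form. -/
theorem IsCalmLocalMinimax.fderiv_snd_nonpos (h : IsCalmLocalMinimax f X Y x₀ y₀)
    (hf : HasFDerivAt f f' (x₀, y₀)) {v : F} (hv : v ∈ contingentCone (Y x₀) y₀) :
    f' (0, v) ≤ 0 := by
  obtain ⟨hx₀, -, δ₀, τ, hδ₀, -, -, hmm⟩ := h
  obtain ⟨t, w, htpos, ht, hw, htw⟩ := hv
  have hd : Tendsto (fun k => ((0 : E), t k • w k)) atTop (𝓝 0) :=
    (tendsto_const_nhds (x := (0 : E))).prodMk_nhds (by simpa using ht.smul hw)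
  have hlim : Tendsto (fun k => (t k)⁻¹ • (f ((x₀, y₀) + (0, t k • w k)) - f (x₀, y₀))) atTop
      (𝓝 (f' (0, v))) := by
    refine hf.hasFDerivWithinAt.lim (s := Set.univ) hd (.of_forall fun _ => Set.mem_univ _) ?_
    simpa only [Prod.smul_mk, smul_zero, inv_smul_smul₀ (htpos _).ne'] using
      (tendsto_const_nhds (x := (0 : E))).prodMk_nhds hw
  refine le_of_tendsto hlim ?_
  have hball : ∀ᶠ k in atTop, y₀ + t k • w k ∈ Metric.closedBall y₀ δ₀ := by
    have : Tendsto (fun k => y₀ + t k • w k) atTop (𝓝 y₀) := by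
      simpa using (ht.smul hw).const_add y₀
    exact this (Metric.closedBall_mem_nhds _ hδ₀)
  filter_upwards [hball] with k hk
  have := (hmm δ₀ hδ₀ le_rfl x₀ ⟨hx₀, Metric.mem_closedBall_self δ₀.2⟩ _ ⟨htw k, hk⟩).1
  simp only [Prod.mk_add_mk, add_zero, smul_eq_mul]
  exact mul_nonpos_of_nonneg_of_nonpos (inv_nonneg.2 (htpos k).le) (sub_nonpos.2 this)

/-- Every direction tangent to `X` has a response tangent to the graph of `Y` that does not
decrease `f` to first order. Calmness bounds the response. -/
theorem IsCalmLocalMinimax.exists_fderiv_nonneg [FiniteDimensional ℝ F]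
    (h : IsCalmLocalMinimax f X Y x₀ y₀) (hf : HasFDerivAt f f' (x₀, y₀)) {u : E}
    (hu : u ∈ contingentCone X x₀) :
    ∃ (v : F) (t : ℕ → ℝ) (d : ℕ → E × F), (∀ k, 0 < t k) ∧ Tendsto t atTop (𝓝 0) ∧
      Tendsto d atTop (𝓝 (u, v)) ∧ (∀ k, y₀ + t k • (d k).2 ∈ Y (x₀ + t k • (d k).1)) ∧
      0 ≤ f' (u, v) := by
  obtain ⟨-, hy₀, δ₀, τ, hδ₀, -, ⟨κ, -, hκ⟩, hmm⟩ := h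
  obtain ⟨t, w, htpos, ht, hw, htw⟩ := hu
  -- Eventually `‖w k‖ ≤ R`, so the radius `δ k = t k * R` captures `x₀ + t k • w k`, and calmness
  -- bounds the scaled responses by `κ * R`.
  set R : ℝ := ‖u‖ + 1 with hRdef
  have hR : 0 < R := by positivity
  let δ : ℕ → ℝ≥0 := fun k => Real.toNNReal (t k * R)
  have hδ : ∀ k, ((δ k : ℝ≥0) : ℝ) = t k * R := fun k =>
    Real.coe_toNNReal _ (mul_pos (htpos k) hR).le
  have hδpos : ∀ k, 0 < δ k := fun k => Real.toNNReal_pos.2 (mul_pos (htpos k) hR)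
  have hδlim : Tendsto δ atTop (𝓝[>] 0) := by
    refine tendsto_nhdsWithin_iff.2 ⟨?_, .of_forall hδpos⟩
    rw [← NNReal.tendsto_coe]
    simpa [hδ] using ht.mul_const R
  have hev : ∀ᶠ k in atTop, τ (δ k) ≤ κ * δ k ∧ δ k ≤ δ₀ ∧ ‖w k‖ ≤ R := by
    refine (hδlim.eventually hκ).and (Eventually.and ?_ ?_)
    · exact ((hδlim.mono_right nhdsWithin_le_nhds).eventually_lt_const hδ₀).mono fun _ h => h.le
    · exact (hw.norm.eventually_lt_const (lt_add_one ‖u‖)).mono fun _ h => h.le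
  have hex : ∀ᶠ k in atTop, ∃ v : F, ‖v‖ ≤ κ * R ∧ y₀ + t k • v ∈ Y (x₀ + t k • w k) ∧
      f (x₀, y₀) ≤ f (x₀ + t k • w k, y₀ + t k • v) := by
    filter_upwards [hev] with k ⟨hk1, hk2, hk3⟩
    have hxk : x₀ + t k • w k ∈ Metric.closedBall x₀ (δ k) := by
      rw [mem_closedBall_iff_norm, add_sub_cancel_left, norm_smul,
        Real.norm_of_nonneg (htpos k).le, hδ]
      exact mul_le_mul_of_nonneg_left hk3 (htpos k).le
    obtain ⟨-, M, ⟨⟨y, ⟨hyY, hyb⟩, hyM⟩, -⟩, hM⟩ := hmm (δ k) (hδpos k) hk2 _ ⟨htw k, hxk⟩ y₀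
      ⟨hy₀, Metric.mem_closedBall_self (δ k).2⟩
    have hynorm : ‖y - y₀‖ ≤ κ * (t k * R) := by
      rw [mem_closedBall_iff_norm] at hyb
      have : (τ (δ k) : ℝ) ≤ κ * δ k := by exact_mod_cast hk1
      rw [hδ] at this
      exact hyb.trans this
    have hy : y₀ + t k • ((t k)⁻¹ • (y - y₀)) = y := by
      rw [smul_inv_smul₀ (htpos k).ne', add_sub_cancel]
    refine ⟨(t k)⁻¹ • (y - y₀), ?_, by rwa [hy], ?_⟩
    · rw [norm_smul, norm_inv, Real.norm_of_nonneg (htpos k).le, ← div_eq_inv_mul,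
        div_le_iff₀ (htpos k)]
      linarith
    · rw [hy]
      exact hM.trans_eq hyM.symm
  obtain ⟨N, hN⟩ := eventually_atTop.1 hex
  choose v hv hvY hvf using fun k => hN (k + N) (Nat.le_add_left _ _)
  obtain ⟨a, -, φ, hφ, hva⟩ := (isCompact_closedBall (0 : F) (κ * R)).tendsto_subseq
    (fun k => mem_closedBall_zero_iff.2 (hv k))
  have hψ : Tendsto (fun k => φ k + N) atTop atTop :=
    (tendsto_add_atTop_nat N).comp hφ.tendsto_atTop
  have ht' : Tendsto (fun k => t (φ k + N)) atTop (𝓝 0) := ht.comp hψ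
  have hd : Tendsto (fun k => (w (φ k + N), v (φ k))) atTop (𝓝 (u, a)) :=
    (hw.comp hψ).prodMk_nhds hva
  refine ⟨a, fun k => t (φ k + N), fun k => (w (φ k + N), v (φ k)), fun k => htpos _, ht', hd,
    fun k => hvY _, ?_⟩
  have hlim : Tendsto (fun k => (t (φ k + N))⁻¹ •
      (f ((x₀, y₀) + t (φ k + N) • (w (φ k + N), v (φ k))) - f (x₀, y₀))) atTop
      (𝓝 (f' (u, a))) := by
    refine hf.hasFDerivWithinAt.lim (s := Set.univ) ?_ (.of_forall fun _ => Set.mem_univ _) ?_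
    · simpa using ht'.smul hd
    · simpa only [inv_smul_smul₀ (htpos _).ne'] using hd
  refine ge_of_tendsto' hlim fun k => ?_
  exact mul_nonneg (inv_nonneg.2 (htpos _).le) (sub_nonneg.2 (hvf _))

end FirstOrder

/-! ### Assembling the two multipliers. -/

/-- Calm local minimax points satisfy the first-order multiplier rule as soon as both constraint
systems are metrically subregular. -/
theorem IsCalmLocalMinimax.exists_multipliers {E F P Q : Type*}
    [NormedAddCommGroup E] [InnerProductSpace ℝ E] [FiniteDimensional ℝ E]
    [NormedAddCommGroup F] [InnerProductSpace ℝ F] [FiniteDimensional ℝ F]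
    [NormedAddCommGroup P] [InnerProductSpace ℝ P] [FiniteDimensional ℝ P]
    [NormedAddCommGroup Q] [InnerProductSpace ℝ Q] [FiniteDimensional ℝ Q]
    {f : E × F → ℝ} {phi : E → P} {varphi : E × F → Q} {C : Set P} {D : Set Q}
    {x₀ : E} {y₀ : F} {f' : E × F →L[ℝ] ℝ} {phi' : E →L[ℝ] P} {varphi' : E × F →L[ℝ] Q}
    (hf : HasFDerivAt f f' (x₀, y₀)) (hphi : HasFDerivAt phi phi' x₀)
    (hvarphi : HasFDerivAt varphi varphi' (x₀, y₀)) (hC : Convex ℝ C) (hD : Convex ℝ D)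
    (h : IsCalmLocalMinimax f {x | phi x ∈ C} (fun x => {y | varphi (x, y) ∈ D}) x₀ y₀)
    (hX : MSCQ phi C x₀) (hY : MSCQ (fun y => varphi (x₀, y)) D y₀) :
    ∃ α ∈ normalCone C (phi x₀), ∃ β ∈ normalCone D (varphi (x₀, y₀)),
      ∀ u v, f' (u, v) + inner ℝ α (phi' u) - inner ℝ β (varphi' (u, v)) = 0 := by
  have hY' : HasFDerivAt (fun y => varphi (x₀, y)) (varphi' ∘L .inr ℝ E F) y₀ :=
    hvarphi.comp y₀ (hasFDerivAt_prodMk_right x₀ y₀)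
  obtain ⟨β, hβ, hβv⟩ := hY.exists_multiplier hD hY' (f' ∘L .inr ℝ E F)
    fun v hv => by simpa using h.fderiv_snd_nonpos hf hv
  obtain ⟨α, hα, hαu⟩ := hX.exists_multiplier hC hphi
    ((innerSL ℝ β ∘L varphi' - f') ∘L .inl ℝ E F) (by
      intro u hu
      obtain ⟨v, t, d, htpos, ht, hd, htd, hv⟩ := h.exists_fderiv_nonneg hf hu
      have hlim : Tendsto (fun k => (t k)⁻¹ •
          (varphi ((x₀, y₀) + t k • d k) - varphi (x₀, y₀))) atTop (𝓝 (varphi' (u, v))) := by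
        refine hvarphi.hasFDerivWithinAt.lim (s := Set.univ) ?_
          (.of_forall fun _ => Set.mem_univ _) ?_
        · simpa using ht.smul hd
        · simpa only [inv_smul_smul₀ (htpos _).ne'] using hd
      -- Each difference quotient is a positive multiple of a point of `D` minus `varphi (x₀, y₀)`,
      -- where the global normal inequality for `β` applies.
      have hle : inner ℝ β (varphi' (u, v)) ≤ 0 := by
        refine le_of_tendsto' (tendsto_const_nhds.inner hlim) fun k => ?_
        rw [inner_smul_right]
        exact mul_nonpos_of_nonneg_of_nonpos (inv_nonneg.2 (htpos k).le) (hβ _ (htd k))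
      have hsplit : ((u, v) : E × F) = (u, 0) + (0, v) := by simp
      have hβv' := hβv v
      simp only [ContinuousLinearMap.comp_apply, ContinuousLinearMap.inr_apply] at hβv'
      -- By `hβv'` the contributions of `(0, v)` to `hv` and `hle` are equal, hence drop out.
      rw [hsplit, map_add] at hv hle
      rw [inner_add_right] at hle
      simp only [ContinuousLinearMap.comp_apply, ContinuousLinearMap.inl_apply,
        _root_.sub_apply, innerSL_apply_apply]
      linarith)
  refine ⟨α, mem_normalCone_of_forall_inner_le hX.1 hα, β,
    mem_normalCone_of_forall_inner_le hY.1 hβ, fun u v => ?_⟩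
  have hu := hαu u
  have hv := hβv v
  have hsplit : ((u, v) : E × F) = (u, 0) + (0, v) := by simp
  simp only [ContinuousLinearMap.comp_apply, ContinuousLinearMap.inl_apply,
    ContinuousLinearMap.inr_apply, _root_.sub_apply, innerSL_apply_apply] at hu hv
  rw [hsplit, map_add, map_add, inner_add_right]
  linarith

end CalmMinimax

theorem mainTheorem4 {n m p q : ℕ}
    (f : EuclideanSpace ℝ (Fin n) × EuclideanSpace ℝ (Fin m) → ℝ)
    (phi : EuclideanSpace ℝ (Fin n) → EuclideanSpace ℝ (Fin p))
    (varphi : EuclideanSpace ℝ (Fin n) × EuclideanSpace ℝ (Fin m) → EuclideanSpace ℝ (Fin q))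
    (C : Set (EuclideanSpace ℝ (Fin p))) (D : Set (EuclideanSpace ℝ (Fin q)))
    (hf : ContDiff ℝ 1 f) (hphi : ContDiff ℝ 1 phi) (hvarphi : ContDiff ℝ 1 varphi)
    (hC : IsClosed C) (hC' : Convex ℝ C) (hD : IsClosed D) (hD' : Convex ℝ D)
    (xbar : EuclideanSpace ℝ (Fin n)) (ybar : EuclideanSpace ℝ (Fin m))
    (hminimax : CalmMinimax.IsCalmLocalMinimax f {x | phi x ∈ C} (fun x => {y | varphi (x, y) ∈ D})
      xbar ybar)
    (hMSCQX : CalmMinimax.MSCQ phi C xbar)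
    (hMSCQY : CalmMinimax.MSCQ (fun y => varphi (xbar, y)) D ybar)
    (hRS : CalmMinimax.RobinsonStable varphi D xbar ybar)
    (hreg : ∀ u ∈ CalmMinimax.contingentCone {x | phi x ∈ C} xbar,
      ∀ h ∈ CalmMinimax.linearizedCone varphi D xbar ybar u,
        CalmMinimax.DirectionallyRegular varphi D xbar ybar u h) :
    ∃ α ∈ CalmMinimax.normalCone C (phi xbar),
      ∃ β ∈ CalmMinimax.normalCone D (varphi (xbar, ybar)),
        HasFDerivAt (𝕜 := ℝ) (fun z : EuclideanSpace ℝ (Fin n) × EuclideanSpace ℝ (Fin m) =>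
          CalmMinimax.lagrangian f phi varphi z.1 z.2 α β) 0 (xbar, ybar) := by
  have hf' := (hf.differentiable one_ne_zero (xbar, ybar)).hasFDerivAt
  have hphi' := (hphi.differentiable one_ne_zero xbar).hasFDerivAt
  have hvarphi' := (hvarphi.differentiable one_ne_zero (xbar, ybar)).hasFDerivAt
  obtain ⟨α, hα, β, hβ, h⟩ :=
    hminimax.exists_multipliers hf' hphi' hvarphi' hC' hD' hMSCQX hMSCQY
  refine ⟨α, hα, β, hβ, ?_⟩
  have hL := (hf'.add ((hphi'.comp (xbar, ybar) hasFDerivAt_fst).inner ℝ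
    (hasFDerivAt_const α (xbar, ybar)))).sub (hvarphi'.inner ℝ (hasFDerivAt_const β (xbar, ybar)))
  refine hL.congr_fderiv (ContinuousLinearMap.ext fun ⟨u, v⟩ => ?_)
  simpa [real_inner_comm] using h u v
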